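/- A sequence of rationals is computable if some algorithm outputs its $n$-th term as an explicit fraction on input $n$. A real is left-c.e. (right-c.e.) if it is the limit of a computable increasing (respectively decreasing) sequence of rationals; the sequence need not be strictly monotone. A Martin-Löf test is a sequence $(U_i)_{i\in\mathbb N}$ of subsets of $\mathbb R$ with Lebesgue measure $\mu(U_i)\le 2^{-i}$ such that each $U_i$ is a union of open intervals with rational end points that are computably enumerable uniformly in $i$; a real $x$ is Martin-Löf random if $x\notin\bigcap_i U_i$ for every Martin-Löf test $(U_i)$. For reals $\alpha,\beta$ let $$\mathcal D(\alpha,\beta)=\inf\{\,q\in\mathbb Q : q>0 \text{ and } q\alpha-\beta \text{ is a left-c.e. real}\,\},$$ with $\inf\emptyset=+\infty$. **Theorem.** Let $\alpha,\beta$ be Martin-Löf random left-c.e. reals. Then (a) if $\mathcal D(\alpha,\beta)<1$, then $\alpha-\beta$ is a Martin-Löf random left-c.e. real; (b) if $\mathcal D(\alpha,\beta)=1$, then $\alpha-\beta$ is not Martin-Löf random; (c) if $\mathcal D(\alpha,\beta)>1$, then $\alpha-\beta$ is a Martin-Löf random right-c.e. real. -/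

import Mathlib

namespace RandomReals

/-- The rational number coded by a triple `(a, b, c)` of natural numbers: `(a - b) / (c + 1)`.
Every rational has a code. -/
def ratOfCode (c : ℕ × ℕ × ℕ) : ℚ := ((c.1 : ℚ) - (c.2.1 : ℚ)) / ((c.2.2 : ℚ) + 1)

/-- A computable sequence of rationals: one whose terms have codes given by a computable
function of the index. -/
def IsComputableRatSeq (a : ℕ → ℚ) : Prop :=
  ∃ c : ℕ → ℕ × ℕ × ℕ, Computable c ∧ ∀ n, a n = ratOfCode (c n)

/-- `x` is left-c.e.: the limit of a computable increasing sequence of rationals. -/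
def IsLeftCE (x : ℝ) : Prop :=
  ∃ a : ℕ → ℚ, IsComputableRatSeq a ∧ Monotone a ∧
    Filter.Tendsto (fun n => (a n : ℝ)) Filter.atTop (nhds x)

/-- `x` is right-c.e.: the limit of a computable decreasing sequence of rationals. -/
def IsRightCE (x : ℝ) : Prop :=
  ∃ a : ℕ → ℚ, IsComputableRatSeq a ∧ Antitone a ∧
    Filter.Tendsto (fun n => (a n : ℝ)) Filter.atTop (nhds x)

/-- A uniformly c.e. sequence of effectively open sets of reals: `U i` is the union of the open
intervals with rational end points that are listed by a function computable uniformly in `i`.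
An interval whose left end point is not smaller than its right end point is empty, so sets with
an empty or a finite enumeration are covered too. -/
def IsUniformlyEffectivelyOpen (U : ℕ → Set ℝ) : Prop :=
  ∃ f : ℕ → ℕ → (ℕ × ℕ × ℕ) × (ℕ × ℕ × ℕ), Computable₂ f ∧
    ∀ i, U i = ⋃ n, Set.Ioo (ratOfCode (f i n).1 : ℝ) (ratOfCode (f i n).2 : ℝ)

/-- A Martin-Löf test: a uniformly c.e. sequence of effectively open sets `U i` of Lebesgue
measure at most `2 ^ (-i)`. -/
def IsMartinLofTest (U : ℕ → Set ℝ) : Prop :=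
  IsUniformlyEffectivelyOpen U ∧
    ∀ i, MeasureTheory.volume (U i) ≤ ((2 : ENNReal) ^ i)⁻¹

/-- `x` is Martin-Löf random: it lies in the intersection of no Martin-Löf test. -/
def IsMartinLofRandom (x : ℝ) : Prop :=
  ∀ U : ℕ → Set ℝ, IsMartinLofTest U → x ∉ ⋂ i, U i

/-- `D(α, β)`: the infimum of the positive rationals `q` such that `q * α - β` is left-c.e.,
taken in the extended reals, where the infimum of the empty set is `⊤`. -/
noncomputable def D (α β : ℝ) : EReal :=
  sInf {x : EReal | ∃ q : ℚ, 0 < q ∧ IsLeftCE ((q : ℝ) * α - β) ∧ x = ((q : ℝ) : EReal)}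

end RandomReals

/-! Fix computable increasing sequences `a` → α and `b` → β and look at the slopes (β - b s) / (α -
a s). The heart of the proof is that randomness of α stops the slopes from being infinitely often
below c and infinitely often above d > c (`not_frequently_cross`): otherwise nested searches for low
and then high slopes capture α in sets whose measure drops by the factor c / d per round.

Hence one of three cases holds (`trichotomy`). If the slopes are eventually at most some q < 1, then
qα - β is left-c.e. and α - β = (1 - q)α + (qα - β). If they are eventually at least some q > 1,
then β - qα is left-c.e. and β - α = (q - 1)α + (β - qα). Both sums are random, because a random
left-c.e. real plus a left-c.e. real is random (`IsMartinLofRandom.add`).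

Otherwise the slopes tend to 1, and the error of `a s - b s` as an approximation to α - β is o(α - a
s). Either this approximation crosses α - β infinitely often, and its bounded variation refutes
randomness by Markov's inequality, or it is eventually on one side and converges too fast for a
random real. The value of D tells the cases apart, since a left-c.e. β - qα forces D ≥ q
(`le_D_of_isLeftCE_sub`). -/

namespace RandomReals
open Filter Topology MeasureTheory

/-! ### Computable rational arithmetic on codes. -/

section ComputableRat

variable {σ τ : Type*} [Primcodable σ] [Primcodable τ]

/-- A rational-valued function is computable if codes of its values can be computed. -/
def ComputableRat (f : σ → ℚ) : Prop :=
  ∃ c : σ → ℕ × ℕ × ℕ, Computable c ∧ ∀ x, f x = ratOfCode (c x)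

theorem exists_ratOfCode (q : ℚ) : ∃ c, q = ratOfCode c := by
  refine ⟨(q.num.toNat, (-q.num).toNat, q.den - 1), ?_⟩
  have hden : ((q.den - 1 : ℕ) : ℚ) + 1 = q.den := by
    rw [Nat.cast_sub q.den_pos]; simp
  have hnum : ((q.num.toNat : ℕ) : ℚ) - ((-q.num).toNat : ℕ) = q.num := by
    have : (q.num.toNat : ℤ) - ((-q.num).toNat : ℤ) = q.num := by omega
    exact_mod_cast this
  simp only [ratOfCode, hden, hnum]
  exact (Rat.num_div_den q).symm

theorem computable₂_nat_add : Computable₂ ((· + ·) : ℕ → ℕ → ℕ) := Primrec.nat_add.to_comp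
theorem computable₂_nat_mul : Computable₂ ((· * ·) : ℕ → ℕ → ℕ) := Primrec.nat_mul.to_comp
theorem computable₂_nat_sub : Computable₂ ((· - ·) : ℕ → ℕ → ℕ) := Primrec.nat_sub.to_comp

theorem _root_.Computable.nat_add {f g : σ → ℕ} (hf : Computable f) (hg : Computable g) :
    Computable fun x => f x + g x := computable₂_nat_add.comp hf hg
theorem _root_.Computable.nat_mul {f g : σ → ℕ} (hf : Computable f) (hg : Computable g) :
    Computable fun x => f x * g x := computable₂_nat_mul.comp hf hg
theorem _root_.Computable.nat_sub {f g : σ → ℕ} (hf : Computable f) (hg : Computable g) :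
    Computable fun x => f x - g x := computable₂_nat_sub.comp hf hg

theorem _root_.Computable.nat_le {f g : σ → ℕ} (hf : Computable f) (hg : Computable g) :
    Computable fun x => decide (f x ≤ g x) :=
  (Primrec.nat_le.decide.to_comp : Computable₂ fun a b : ℕ => decide (a ≤ b)).comp hf hg

theorem _root_.Computable.ite_decide {p : σ → Prop} [DecidablePred p] {f g : σ → τ}
    (hp : Computable fun x => decide (p x)) (hf : Computable f) (hg : Computable g) :
    Computable fun x => if p x then f x else g x :=
  (Computable.cond hp hf hg).of_eq fun x => by by_cases h : p x <;> simp [h]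

/-- Codes store the denominator minus one, so a product of denominators is lowered by one before
being stored. -/
theorem cast_pred_succ_mul_succ (m n : ℕ) :
    ((Nat.pred (Nat.succ m * Nat.succ n) : ℕ) : ℚ) + 1 = (m + 1) * (n + 1) := by
  have : 0 < Nat.succ m * Nat.succ n := by positivity
  exact_mod_cast Nat.succ_pred_eq_of_pos this

namespace ComputableRat

theorem comp {f : τ → ℚ} {g : σ → τ} (hf : ComputableRat f) (hg : Computable g) :
    ComputableRat fun x => f (g x) := by
  obtain ⟨c, hc, h⟩ := hf
  exact ⟨fun x => c (g x), hc.comp hg, fun x => h _⟩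

theorem const (q : ℚ) : ComputableRat fun _ : σ => q := by
  obtain ⟨c, hc⟩ := exists_ratOfCode q
  exact ⟨fun _ => c, Computable.const c, fun _ => hc⟩

theorem natCast {f : σ → ℕ} (hf : Computable f) : ComputableRat fun x => (f x : ℚ) :=
  ⟨fun x => (f x, 0, 0), hf.pair (Computable.const _), fun x => by simp [ratOfCode]⟩

theorem two_pow_inv {f : σ → ℕ} (hf : Computable f) :
    ComputableRat fun x => ((2 : ℚ) ^ f x)⁻¹ := by
  refine ⟨fun x => (1, 0, 2 ^ f x - 1), (Computable.const 1).pair ((Computable.const 0).pair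
    (Computable.nat_sub ?_ (Computable.const 1))), fun x => ?_⟩
  · have : Computable fun n : ℕ => 2 ^ n :=
      (Computable.nat_rec (α := ℕ) (f := fun n => n) (g := fun _ => 1) (h := fun _ p => p.2 * 2)
        Computable.id (Computable.const 1) (Computable.nat_mul (Computable.snd.comp Computable.snd)
          (Computable.const 2)).to₂).of_eq fun n => by
          induction n with
          | zero => rfl
          | succ n ih => simp only [] at ih ⊢; rw [ih, pow_succ]
    exact this.comp hf
  · have : 1 ≤ 2 ^ f x := Nat.one_le_two_pow
    simp [ratOfCode, Nat.cast_sub this]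

variable {f g : σ → ℚ}

theorem neg (hf : ComputableRat f) : ComputableRat fun x => -f x := by
  obtain ⟨c, hc, h⟩ := hf
  refine ⟨fun x => ((c x).2.1, (c x).1, (c x).2.2), ?_, fun x => ?_⟩
  · exact (Computable.fst.comp (Computable.snd.comp hc)).pair ((Computable.fst.comp hc).pair
      (Computable.snd.comp (Computable.snd.comp hc)))
  · simp only [h, ratOfCode]; ring

theorem add (hf : ComputableRat f) (hg : ComputableRat g) : ComputableRat fun x => f x + g x := by
  obtain ⟨c, hc, h⟩ := hf
  obtain ⟨d, hd, k⟩ := hg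
  have c1 := Computable.fst.comp hc
  have c2 := Computable.fst.comp (Computable.snd.comp hc)
  have c3 := Computable.succ.comp (Computable.snd.comp (Computable.snd.comp hc))
  have d1 := Computable.fst.comp hd
  have d2 := Computable.fst.comp (Computable.snd.comp hd)
  have d3 := Computable.succ.comp (Computable.snd.comp (Computable.snd.comp hd))
  refine ⟨_, ((c1.nat_mul d3).nat_add (d1.nat_mul c3)).pair
    (((c2.nat_mul d3).nat_add (d2.nat_mul c3)).pair
      (Computable.pred.comp (c3.nat_mul d3))), fun x => ?_⟩
  simp only [h, k, ratOfCode, cast_pred_succ_mul_succ]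
  push_cast
  have h1 : ((c x).2.2 + 1 : ℚ) ≠ 0 := by positivity
  have h2 : ((d x).2.2 + 1 : ℚ) ≠ 0 := by positivity
  field_simp
  ring

theorem mul (hf : ComputableRat f) (hg : ComputableRat g) : ComputableRat fun x => f x * g x := by
  obtain ⟨c, hc, h⟩ := hf
  obtain ⟨d, hd, k⟩ := hg
  have c1 := Computable.fst.comp hc
  have c2 := Computable.fst.comp (Computable.snd.comp hc)
  have c3 := Computable.succ.comp (Computable.snd.comp (Computable.snd.comp hc))
  have d1 := Computable.fst.comp hd
  have d2 := Computable.fst.comp (Computable.snd.comp hd)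
  have d3 := Computable.succ.comp (Computable.snd.comp (Computable.snd.comp hd))
  refine ⟨_, ((c1.nat_mul d1).nat_add (c2.nat_mul d2)).pair
    (((c1.nat_mul d2).nat_add (c2.nat_mul d1)).pair
      (Computable.pred.comp (c3.nat_mul d3))), fun x => ?_⟩
  simp only [h, k, ratOfCode, cast_pred_succ_mul_succ]
  push_cast
  have h1 : ((c x).2.2 + 1 : ℚ) ≠ 0 := by positivity
  have h2 : ((d x).2.2 + 1 : ℚ) ≠ 0 := by positivity
  field_simp
  ring

theorem sub (hf : ComputableRat f) (hg : ComputableRat g) : ComputableRat fun x => f x - g x := by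
  simpa only [sub_eq_add_neg] using hf.add hg.neg

theorem decide_le (hf : ComputableRat f) (hg : ComputableRat g) :
    Computable fun x => decide (f x ≤ g x) := by
  obtain ⟨c, hc, h⟩ := hf
  obtain ⟨d, hd, k⟩ := hg
  have c1 := Computable.fst.comp hc
  have c2 := Computable.fst.comp (Computable.snd.comp hc)
  have c3 := Computable.succ.comp (Computable.snd.comp (Computable.snd.comp hc))
  have d1 := Computable.fst.comp hd
  have d2 := Computable.fst.comp (Computable.snd.comp hd)
  have d3 := Computable.succ.comp (Computable.snd.comp (Computable.snd.comp hd))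
  refine (((c1.nat_mul d3).nat_add (d2.nat_mul c3)).nat_le
    ((d1.nat_mul c3).nat_add (c2.nat_mul d3))).of_eq fun x => ?_
  simp only [h, k, ratOfCode]
  congr 1
  rw [eq_iff_iff]
  rw [div_le_div_iff₀ (by positivity) (by positivity), ← Nat.cast_le (α := ℚ)]
  push_cast
  constructor <;> intro h <;> linarith

theorem decide_lt (hf : ComputableRat f) (hg : ComputableRat g) :
    Computable fun x => decide (f x < g x) :=
  ((Primrec.not.to_comp).comp (hg.decide_le hf)).of_eq fun x => by
    rw [← decide_not]; congr 1; simp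

theorem ite_decide {p : σ → Prop} [DecidablePred p] (hp : Computable fun x => decide (p x))
    (hf : ComputableRat f) (hg : ComputableRat g) :
    ComputableRat fun x => if p x then f x else g x := by
  obtain ⟨c, hc, h⟩ := hf
  obtain ⟨d, hd, k⟩ := hg
  refine ⟨_, Computable.ite_decide hp hc hd, fun x => ?_⟩
  by_cases hx : p x <;> simp [hx, h, k]

end ComputableRat

end ComputableRat
end RandomReals

namespace RandomReals
open Filter Topology MeasureTheory

/-! ### Martin-Löf tests and elementary closure properties of randomness. -/

section Tests

/-- Allows tests indexed by any encodable type. Numbers that decode to nothing are sent to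
`default`, whose interval is in the union anyway. -/
theorem IsUniformlyEffectivelyOpen.of_computableRat {τ : Type*} [Primcodable τ] [Inhabited τ]
    {U : ℕ → Set ℝ} {l r : ℕ × τ → ℚ} (hl : ComputableRat l) (hr : ComputableRat r)
    (hU : ∀ i, U i = ⋃ x : τ, Set.Ioo (l (i, x) : ℝ) (r (i, x) : ℝ)) :
    IsUniformlyEffectivelyOpen U := by
  have he : Computable fun p : ℕ × ℕ => (p.1, ((Encodable.decode p.2).getD default : τ)) :=
    Computable.fst.pair
      (Computable.option_getD (Computable.decode.comp Computable.snd) (Computable.const _))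
  obtain ⟨c, hc, h⟩ := hl.comp he
  obtain ⟨d, hd, k⟩ := hr.comp he
  refine ⟨fun i n => (c (i, n), d (i, n)), (hc.pair hd).to₂, fun i => ?_⟩
  simp only [← h, ← k, hU]
  ext y
  simp only [Set.mem_iUnion]
  constructor
  · rintro ⟨x, hx⟩
    exact ⟨Encodable.encode x, by simpa using hx⟩
  · rintro ⟨n, hn⟩
    exact ⟨_, hn⟩

theorem IsUniformlyEffectivelyOpen.exists_computableRat {U : ℕ → Set ℝ}
    (h : IsUniformlyEffectivelyOpen U) :
    ∃ l r : ℕ × ℕ → ℚ, ComputableRat l ∧ ComputableRat r ∧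
      ∀ i, U i = ⋃ n, Set.Ioo (l (i, n) : ℝ) (r (i, n) : ℝ) := by
  obtain ⟨f, hf, h⟩ := h
  exact ⟨fun p => ratOfCode (f p.1 p.2).1, fun p => ratOfCode (f p.1 p.2).2,
    ⟨_, Computable.fst.comp hf, fun _ => rfl⟩, ⟨_, Computable.snd.comp hf, fun _ => rfl⟩, h⟩

theorem IsUniformlyEffectivelyOpen.comp {U : ℕ → Set ℝ} (h : IsUniformlyEffectivelyOpen U)
    {k : ℕ → ℕ} (hk : Computable k) : IsUniformlyEffectivelyOpen fun i => U (k i) := by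
  obtain ⟨f, hf, h⟩ := h
  exact ⟨fun i n => f (k i) n, Computable.to₂ (hf.comp (hk.comp Computable.fst) Computable.snd),
    fun i => h _⟩

/-- A random real is captured by no effectively open sequence of geometrically decreasing
measure. -/
theorem IsMartinLofRandom.exists_notMem {x : ℝ} (hx : IsMartinLofRandom x) {U : ℕ → Set ℝ}
    (hU : IsUniformlyEffectivelyOpen U) {C κ : ℝ} (hκ0 : 0 ≤ κ) (hκ : κ < 1)
    (hm : ∀ i, volume (U i) ≤ ENNReal.ofReal (C * κ ^ i)) : ∃ i, x ∉ U i := by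
  by_contra! hall
  -- Thinning the sequence by `k` turns the ratio κ into at most 1/2, and the shift by `j` absorbs
  -- the constant `C`.
  obtain ⟨k, hk⟩ := exists_pow_lt_of_lt_one (by norm_num : (0 : ℝ) < 1 / 2) hκ
  obtain ⟨j, hj⟩ := exists_pow_lt_of_lt_one (by positivity : (0 : ℝ) < 1 / (|C| + 1)) hκ
  refine hx (fun i => U (k * i + j)) ⟨hU.comp ?_, fun i => (hm _).trans ?_⟩
    (Set.mem_iInter.2 fun i => hall _)
  · exact ((Computable.const k).nat_mul Computable.id).nat_add (Computable.const j)
  · have e : ((2 : ENNReal) ^ i)⁻¹ = ENNReal.ofReal ((1 / 2) ^ i) := by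
      rw [one_div, ENNReal.ofReal_pow (by positivity), ENNReal.ofReal_inv_of_pos two_pos,
        ENNReal.inv_pow]
      simp
    rw [e]
    apply ENNReal.ofReal_le_ofReal
    have h1 : (κ ^ k) ^ i ≤ (1 / 2) ^ i := pow_le_pow_left₀ (by positivity) hk.le i
    have h2 : C * κ ^ j ≤ 1 := by
      have : (|C| + 1) * κ ^ j ≤ 1 := by
        rw [lt_div_iff₀ (by positivity)] at hj; linarith
      nlinarith [le_abs_self C, pow_nonneg hκ0 j]
    calc C * κ ^ (k * i + j) = (C * κ ^ j) * (κ ^ k) ^ i := by rw [pow_add, pow_mul]; ring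
      _ ≤ 1 * (κ ^ k) ^ i := by gcongr
      _ ≤ _ := by linarith

theorem IsMartinLofRandom.rat_mul {x : ℝ} (hx : IsMartinLofRandom x) {q : ℚ} (hq : q ≠ 0) :
    IsMartinLofRandom (q * x) := by
  rintro U ⟨hU, hm⟩ hmem
  have hq' : (q : ℝ) ≠ 0 := by exact_mod_cast hq
  have hV : IsUniformlyEffectivelyOpen fun i => ((q : ℝ) * ·) ⁻¹' U i := by
    obtain ⟨l, r, hl, hr, h⟩ := hU.exists_computableRat
    rcases lt_or_gt_of_ne hq with hneg | hpos
    · refine .of_computableRat (hr.mul (.const q⁻¹)) (hl.mul (.const q⁻¹)) fun i => ?_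
      have hneg' : (q : ℝ) < 0 := by exact_mod_cast hneg
      simp only [h, Set.preimage_iUnion, Set.preimage_const_mul_Ioo_of_neg _ _ hneg']
      push_cast
      rfl
    · refine .of_computableRat (hl.mul (.const q⁻¹)) (hr.mul (.const q⁻¹)) fun i => ?_
      have hpos' : (0 : ℝ) < q := by exact_mod_cast hpos
      simp only [h, Set.preimage_iUnion, Set.preimage_const_mul_Ioo₀ _ _ hpos']
      push_cast
      rfl
  obtain ⟨i, hi⟩ := hx.exists_notMem hV (C := |(q : ℝ)⁻¹|) (κ := 1 / 2) (by norm_num) (by norm_num)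
    fun i => by
      rw [Real.volume_preimage_mul_left hq', ENNReal.ofReal_mul (abs_nonneg _)]
      gcongr
      refine (hm i).trans (le_of_eq ?_)
      rw [one_div, ENNReal.ofReal_pow (by positivity), ENNReal.ofReal_inv_of_pos two_pos,
        ENNReal.inv_pow]
      simp
  exact hi (Set.mem_iInter.1 hmem i)

theorem IsMartinLofRandom.neg {x : ℝ} (hx : IsMartinLofRandom x) : IsMartinLofRandom (-x) := by
  simpa using hx.rat_mul (q := -1) (by norm_num)

/-- A real that is both left-c.e. and right-c.e. is not random. -/
theorem not_isMartinLofRandom_of_isLeftCE_of_isRightCE {x : ℝ} (hl : IsLeftCE x)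
    (hr : IsRightCE x) : ¬ IsMartinLofRandom x := by
  obtain ⟨a, ha, hma, hta⟩ := hl
  obtain ⟨b, hb, hmb, htb⟩ := hr
  intro hx
  have hax : ∀ n, (a n : ℝ) ≤ x := fun n =>
    (Rat.cast_mono.comp hma).ge_of_tendsto hta n
  have hbx : ∀ n, x ≤ (b n : ℝ) := fun n =>
    (Rat.cast_mono.comp_antitone hmb).le_of_tendsto htb n
  have c2 : ComputableRat fun p : ℕ × ℕ => ((2 : ℚ) ^ p.1)⁻¹ := .two_pow_inv Computable.fst
  -- `IsComputableRatSeq a` unfolds to `ComputableRat a`, so the closure lemmas apply to sequences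
  -- directly.
  have ca : ComputableRat fun p : ℕ × ℕ => a p.2 := ComputableRat.comp ha Computable.snd
  have cb : ComputableRat fun p : ℕ × ℕ => b p.2 := ComputableRat.comp hb Computable.snd
  -- Once `b n - a n` is small, the interval is widened by 2⁻ⁱ so that `x` is strictly inside.
  -- Before that both end points are 0 and the interval is empty. All later intervals lie in the
  -- first nonempty one.
  let U : ℕ → Set ℝ := fun i => ⋃ n, Set.Ioo
    (((if b n - a n ≤ ((2 : ℚ) ^ i)⁻¹ then a n - ((2 : ℚ) ^ i)⁻¹ else 0 : ℚ)) : ℝ)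
    ((if b n - a n ≤ ((2 : ℚ) ^ i)⁻¹ then b n + ((2 : ℚ) ^ i)⁻¹ else 0 : ℚ) : ℝ)
  have hU : IsUniformlyEffectivelyOpen U := .of_computableRat
    (l := fun p => if b p.2 - a p.2 ≤ ((2 : ℚ) ^ p.1)⁻¹ then a p.2 - ((2 : ℚ) ^ p.1)⁻¹ else 0)
    (r := fun p => if b p.2 - a p.2 ≤ ((2 : ℚ) ^ p.1)⁻¹ then b p.2 + ((2 : ℚ) ^ p.1)⁻¹ else 0)
    (.ite_decide ((cb.sub ca).decide_le c2) (ca.sub c2) (.const 0))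
    (.ite_decide ((cb.sub ca).decide_le c2) (cb.add c2) (.const 0)) fun i => rfl
  have hlim : Tendsto (fun n => (b n : ℝ) - a n) atTop (𝓝 0) := by simpa using htb.sub hta
  have hgood : ∀ i : ℕ, ∃ n, b n - a n ≤ ((2 : ℚ) ^ i)⁻¹ := fun i => by
    obtain ⟨n, hn⟩ := (hlim.eventually_le_const (by positivity : (0 : ℝ) < (2 ^ i)⁻¹)).exists
    exact ⟨n, by rw [← Rat.cast_le (K := ℝ)]; push_cast; exact hn⟩
  obtain ⟨i, hi⟩ := hx.exists_notMem hU (C := 3) (κ := 1 / 2) (by norm_num) (by norm_num)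
    fun i => by
      classical
      have hn := Nat.find_spec (hgood i)
      set n := Nat.find (hgood i)
      have hsub : U i ⊆ Set.Ioo ((a n : ℝ) - (2 ^ i)⁻¹) (b n + (2 ^ i)⁻¹) := by
        refine Set.iUnion_subset fun m => ?_
        split_ifs with hm
        · have hnm : n ≤ m := Nat.find_min' _ hm
          have h1 : (a n : ℝ) ≤ a m := by exact_mod_cast hma hnm
          have h2 : (b m : ℝ) ≤ b n := by exact_mod_cast hmb hnm
          apply Set.Ioo_subset_Ioo <;> push_cast <;> linarith
        · simp
      refine (measure_mono hsub).trans ?_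
      rw [Real.volume_Ioo]
      apply ENNReal.ofReal_le_ofReal
      have : (b n : ℝ) - a n ≤ (2 ^ i)⁻¹ := by
        rw [← Rat.cast_le (K := ℝ)] at hn; push_cast at hn; exact hn
      rw [one_div, inv_pow]
      linarith
  obtain ⟨n, hn⟩ := hgood i
  refine hi (Set.mem_iUnion.2 ⟨n, ?_⟩)
  have : (0 : ℝ) < (2 ^ i)⁻¹ := by positivity
  rw [if_pos hn, if_pos hn]
  push_cast
  exact ⟨by linarith [hax n], by linarith [hbx n]⟩

theorem IsMartinLofRandom.ne_rat {x : ℝ} (hx : IsMartinLofRandom x) (q : ℚ) : x ≠ q := by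
  rintro rfl
  exact not_isMartinLofRandom_of_isLeftCE_of_isRightCE
    ⟨fun _ => q, ComputableRat.const q, monotone_const, tendsto_const_nhds⟩
    ⟨fun _ => q, ComputableRat.const q, antitone_const, tendsto_const_nhds⟩ hx

end Tests
end RandomReals

namespace RandomReals
open Filter Topology MeasureTheory

/-! ### Sums and multiples of left-c.e. reals. -/

section LeftCE

theorem IsLeftCE.add {x y : ℝ} (hx : IsLeftCE x) (hy : IsLeftCE y) : IsLeftCE (x + y) := by
  obtain ⟨a, ha, hma, hta⟩ := hx
  obtain ⟨b, hb, hmb, htb⟩ := hy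
  exact ⟨fun n => a n + b n, ComputableRat.add ha hb, hma.add hmb, by
    push_cast; exact hta.add htb⟩

theorem IsLeftCE.rat_mul {x : ℝ} (hx : IsLeftCE x) {q : ℚ} (hq : 0 ≤ q) : IsLeftCE (q * x) := by
  obtain ⟨a, ha, hma, hta⟩ := hx
  exact ⟨fun n => q * a n, ComputableRat.mul (.const q) ha, hma.const_mul hq, by
    push_cast; exact hta.const_mul _⟩

theorem IsLeftCE.neg {x : ℝ} (hx : IsLeftCE x) : IsRightCE (-x) := by
  obtain ⟨a, ha, hma, hta⟩ := hx
  exact ⟨fun n => - a n, ComputableRat.neg ha, hma.neg, by push_cast; exact hta.neg⟩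

/-- The sum of a random left-c.e. real and a left-c.e. real is random. -/
theorem IsMartinLofRandom.add {x y : ℝ} (hx : IsMartinLofRandom x) (hxl : IsLeftCE x)
    (hy : IsLeftCE y) : IsMartinLofRandom (x + y) := by
  obtain ⟨a, ha, hma, hta⟩ := hxl
  obtain ⟨b, hb, hmb, htb⟩ := hy
  rintro U ⟨hU, hm⟩ hmem
  obtain ⟨l, r, hl, hr, h⟩ := hU.exists_computableRat
  have hma' : Monotone fun n => (a n : ℝ) := Rat.cast_mono.comp hma
  have hmb' : Monotone fun n => (b n : ℝ) := Rat.cast_mono.comp hmb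
  -- When `a s + b s` has passed the left end of an interval of `U i`, its right end shifted by `- b
  -- s` bounds `x`. The default `a s` yields an empty interval.
  let R : ℕ → ℕ → ℕ → ℚ := fun i s n =>
    if l (i, n) < a s + b s then r (i, n) - b s else a s
  let J : ℕ → ℕ → Set ℝ := fun i s => ⋃ n, Set.Ioo (a s : ℝ) (R i s n : ℝ)
  have hJ : IsUniformlyEffectivelyOpen fun i => ⋃ s, J i s := by
    have ca : ComputableRat fun p : ℕ × ℕ × ℕ => a p.2.1 :=
      ComputableRat.comp ha (Computable.fst.comp Computable.snd)
    have cb : ComputableRat fun p : ℕ × ℕ × ℕ => b p.2.1 :=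
      ComputableRat.comp hb (Computable.fst.comp Computable.snd)
    have cin : Computable fun p : ℕ × ℕ × ℕ => (p.1, p.2.2) :=
      Computable.fst.pair (Computable.snd.comp Computable.snd)
    refine .of_computableRat (τ := ℕ × ℕ) ca (.ite_decide ((hl.comp cin).decide_lt (ca.add cb))
      ((hr.comp cin).sub cb) ca) fun i => ?_
    rw [Set.iUnion_prod']
  have hJm : ∀ i s, MeasurableSet (J i s) := fun i s =>
    .iUnion fun n => measurableSet_Ioo
  -- The new part of `J i s`, shifted back by `b s`, lies in `U i`. These shifted parts are pairwise
  -- disjoint, so together they fit inside `U i`.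
  have hvol : ∀ i, volume (⋃ s, J i s) ≤ volume (U i) := fun i => by
    rw [← iUnion_disjointed, measure_iUnion (disjoint_disjointed _)
      (MeasurableSet.disjointed (hJm i))]
    have hpre : ∀ s, volume (disjointed (J i) s)
        = volume ((fun w => w + -(b s : ℝ)) ⁻¹' disjointed (J i) s) := fun s =>
      (measure_preimage_add_right _ _ _).symm
    simp_rw [hpre]
    rw [← measure_iUnion]
    · refine measure_mono (Set.iUnion_subset fun s w hw => ?_)
      obtain ⟨n, hn⟩ := Set.mem_iUnion.1 (disjointed_subset (J i) s hw)
      rw [h]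
      refine Set.mem_iUnion.2 ⟨n, ?_⟩
      simp only [R] at hn
      split_ifs at hn with hc
      · have hc' : (l (i, n) : ℝ) < a s + b s := by exact_mod_cast hc
        push_cast at hn
        exact ⟨by linarith [hn.1], by linarith [hn.2]⟩
      · simp at hn
    · refine (pairwise_disjoint_on _).2 fun s t hst => Set.disjoint_left.2 fun w hws hwt => ?_
      obtain ⟨n, hn⟩ := Set.mem_iUnion.1 (disjointed_subset (J i) s hws)
      obtain ⟨m, hm'⟩ := Set.mem_iUnion.1 (disjointed_subset (J i) t hwt)
      -- Since `a` and `b` increase, a common point `w` would put `w - b t` already in `J i s`, so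
      -- it would not be new at stage `t`.
      have hnot : w + -(b t : ℝ) ∉ J i s := fun hmem' => by
        have hwt' := hwt
        rw [Set.mem_preimage, disjointed_apply] at hwt'
        exact hwt'.2 (Set.mem_of_mem_of_subset hmem'
          (Finset.le_sup (f := J i) (Finset.mem_Iio.2 hst)))
      refine hnot (Set.mem_iUnion.2 ⟨n, ?_, ?_⟩)
      · exact (hma' hst.le).trans_lt hm'.1
      · have := hn.2
        have := hmb' hst.le
        simp only at *
        linarith
    · exact fun s => (MeasurableSet.disjointed (hJm i) s).preimage (measurable_add_const _)
  obtain ⟨i, hi⟩ := hx.exists_notMem hJ (C := 1) (κ := 1 / 2) (by norm_num) (by norm_num)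
    fun i => (hvol i).trans ((hm i).trans (le_of_eq (by
      rw [one_mul, one_div, ENNReal.ofReal_pow (by positivity), ENNReal.ofReal_inv_of_pos two_pos,
        ENNReal.inv_pow]
      simp)))
  have hxy := Set.mem_iInter.1 hmem i
  rw [h] at hxy
  obtain ⟨n, hn⟩ := Set.mem_iUnion.1 hxy
  obtain ⟨s, hs⟩ := ((hta.add htb).eventually_const_lt hn.1).exists
  refine hi (Set.mem_iUnion.2 ⟨s, Set.mem_iUnion.2 ⟨n, ?_⟩⟩)
  have hc : l (i, n) < a s + b s := by exact_mod_cast hs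
  simp only [R, if_pos hc]
  have h1 := hma'.ge_of_tendsto hta s
  have h2 := hmb'.ge_of_tendsto htb s
  push_cast
  exact ⟨lt_of_le_of_ne h1 fun he => hx.ne_rat _ he.symm, by linarith [hn.2]⟩

end LeftCE

/-! ### Running maxima of rational sequences. -/

section LastArgmax

/-- The last index in `[p, t]` at which `g` attains its maximum on `[p, t]`. -/
def lastArgmax (g : ℕ → ℚ) (p t : ℕ) : ℕ :=
  Nat.rec p (fun k m => if g m ≤ g (p + k + 1) then p + k + 1 else m) (t - p)

variable {g : ℕ → ℚ} {p t : ℕ}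

@[simp]
theorem lastArgmax_self : lastArgmax g p p = p := by simp [lastArgmax]

theorem lastArgmax_succ (h : p ≤ t) : lastArgmax g p (t + 1) =
    if g (lastArgmax g p t) ≤ g (t + 1) then t + 1 else lastArgmax g p t := by
  obtain ⟨k, rfl⟩ := Nat.exists_eq_add_of_le h
  have e : p + k + 1 - p = (p + k - p) + 1 := by omega
  have e' : p + (p + k - p) + 1 = p + k + 1 := by omega
  unfold lastArgmax
  rw [e]
  simp only [e']

theorem le_lastArgmax (h : p ≤ t) : p ≤ lastArgmax g p t := by
  induction t, h using Nat.le_induction with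
  | base => simp
  | succ t h ih => rw [lastArgmax_succ h]; split_ifs <;> omega

theorem lastArgmax_le (h : p ≤ t) : lastArgmax g p t ≤ t := by
  induction t, h using Nat.le_induction with
  | base => simp
  | succ t h ih => rw [lastArgmax_succ h]; split_ifs <;> omega

theorem apply_le_apply_lastArgmax {s : ℕ} (hps : p ≤ s) (hst : s ≤ t) :
    g s ≤ g (lastArgmax g p t) := by
  have h : p ≤ t := hps.trans hst
  induction t, h using Nat.le_induction with
  | base => rw [le_antisymm hst hps, lastArgmax_self]
  | succ t h ih =>
    rw [lastArgmax_succ h]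
    rcases hst.lt_or_eq with hlt | rfl
    · have := ih (by omega)
      split_ifs with hc
      · exact this.trans hc
      · exact this
    · split_ifs with hc
      · rfl
      · exact (not_le.1 hc).le

theorem monotone_apply_lastArgmax (g : ℕ → ℚ) : Monotone fun t => g (lastArgmax g 0 t) :=
  monotone_nat_of_le_succ fun t =>
    apply_le_apply_lastArgmax (Nat.zero_le _) ((lastArgmax_le (Nat.zero_le _)).trans t.le_succ)

/-- The argmax stabilizes if some value exceeds all but finitely many of the later ones. -/
theorem exists_eventually_lastArgmax_eq {s : ℕ} (hps : p ≤ s) (h : ∀ᶠ t in atTop, g t < g s) :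
    ∃ m, p ≤ m ∧ g s ≤ g m ∧ ∀ᶠ t in atTop, lastArgmax g p t = m := by
  obtain ⟨N, hN⟩ := eventually_atTop.1 h
  refine ⟨lastArgmax g p (max N s), le_lastArgmax (by omega),
    apply_le_apply_lastArgmax hps (by omega), eventually_atTop.2 ⟨max N s, fun t ht => ?_⟩⟩
  induction t, ht using Nat.le_induction with
  | base => rfl
  | succ t ht ih =>
    rw [lastArgmax_succ (by omega), if_neg (not_le.2 ?_), ih]
    exact (hN _ (by omega)).trans_le (apply_le_apply_lastArgmax hps (by omega))

theorem _root_.Computable.lastArgmax {σ : Type*} [Primcodable σ] {g : σ → ℕ → ℚ} {p t : σ → ℕ}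
    (hg : ComputableRat fun x : σ × ℕ => g x.1 x.2) (hp : Computable p) (ht : Computable t) :
    Computable fun x => lastArgmax (g x) (p x) (t x) := by
  have hnext : Computable fun y : σ × ℕ × ℕ => p y.1 + y.2.1 + 1 :=
    ((hp.comp Computable.fst).nat_add (Computable.fst.comp Computable.snd)).nat_add
      (Computable.const 1)
  have hprev : Computable fun y : σ × ℕ × ℕ => y.2.2 := Computable.snd.comp Computable.snd
  exact Computable.nat_rec (ht.nat_sub hp) hp (h := fun x y =>
    if g x y.2 ≤ g x (p x + y.1 + 1) then p x + y.1 + 1 else y.2)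
    (Computable.ite_decide ((hg.comp (Computable.fst.pair hprev)).decide_le
      (hg.comp (Computable.fst.pair hnext))) hnext hprev).to₂

/-- A computable limit of rationals that are eventually at most the limit is left-c.e. -/
theorem isLeftCE_of_eventually_le {x : ℝ} (hg : IsComputableRatSeq g)
    (ht : Tendsto (fun n => (g n : ℝ)) atTop (𝓝 x)) (hle : ∀ᶠ n in atTop, (g n : ℝ) ≤ x) :
    IsLeftCE x := by
  obtain ⟨N, hN⟩ := eventually_atTop.1 hle
  -- The running maximum of the tail lies between the tail's terms and the limit.
  let f : ℕ → ℚ := fun n => g (n + N)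
  have hf : ComputableRat f :=
    ComputableRat.comp hg (Computable.id.nat_add (Computable.const N))
  refine ⟨fun n => f (lastArgmax f 0 n), hf.comp (.lastArgmax (g := fun _ => f)
    (hf.comp Computable.snd) (Computable.const 0) Computable.id), monotone_apply_lastArgmax f,
    tendsto_of_tendsto_of_tendsto_of_le_of_le (ht.comp (tendsto_add_atTop_nat N))
      tendsto_const_nhds (fun n => ?_) fun n => hN _ (by omega)⟩
  exact Rat.cast_le.2 (apply_le_apply_lastArgmax (g := f) (Nat.zero_le _) le_rfl)

end LastArgmax
end RandomReals

namespace RandomReals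
open Filter Topology MeasureTheory

/-! ### The slopes cannot oscillate. -/

section Crossing

variable (a b : ℕ → ℚ) (c d : ℚ)

/-- Starting from stage `p`, the stage that attains the maximum of `d * a - b` since the last
stage that attained the maximum of `b - c * a`. -/
def crossStep (t p : ℕ) : ℕ :=
  lastArgmax (fun s => d * a s - b s) (lastArgmax (fun s => b s - c * a s) p t) t

/-- The interval of those `x` for which the slope from `(a y, b y)` to `(x, b t)` exceeds `d`. -/
def steepInterval (y t : ℕ) : Set ℝ := Set.Ioo (a y : ℝ) ((a y + (b t - b y) / d : ℚ) : ℝ)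

/-- The union of the intervals produced by `n` nested steps from `p` at the stages in `[p, T]`. -/
def crossSet (n p T : ℕ) : Set ℝ :=
  ⋃ t ∈ Set.Icc p T, steepInterval a b d ((crossStep a b c d t)^[n] p) t

variable {a b c d}

@[simp]
theorem crossStep_self (t : ℕ) : crossStep a b c d t t = t := by simp [crossStep]

theorem iterate_crossStep_self (n t : ℕ) : (crossStep a b c d t)^[n] t = t :=
  Function.iterate_fixed (crossStep_self t) n

@[simp]
theorem steepInterval_self (t : ℕ) : steepInterval a b d t t = ∅ := by simp [steepInterval]

theorem mem_crossSet {n p T : ℕ} {x : ℝ} : x ∈ crossSet a b c d n p T ↔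
    ∃ t, p ≤ t ∧ t ≤ T ∧ x ∈ steepInterval a b d ((crossStep a b c d t)^[n] p) t := by
  simp [crossSet, and_assoc]

theorem crossSet_mono {n p T T' : ℕ} (h : T ≤ T') :
    crossSet a b c d n p T ⊆ crossSet a b c d n p T' := fun x hx => by
  obtain ⟨t, h1, h2, h3⟩ := mem_crossSet.1 hx
  exact mem_crossSet.2 ⟨t, h1, h2.trans h, h3⟩

theorem volume_crossSet_zero_le (hb : Monotone b) (hd : 0 < d) {y T : ℕ} :
    volume (crossSet a b c d 0 y T) ≤ ENNReal.ofReal (((b T - b y) / d : ℚ) : ℝ) := by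
  have hsub : crossSet a b c d 0 y T ⊆ steepInterval a b d y T := fun x hx => by
    obtain ⟨t, -, h2, h3⟩ := mem_crossSet.1 hx
    refine ⟨h3.1, h3.2.trans_le (Rat.cast_le.2 ?_)⟩
    have := hb h2
    simp only [Function.iterate_zero, id]
    gcongr
  refine (measure_mono hsub).trans ?_
  rw [steepInterval, Real.volume_Ioo]
  push_cast
  rw [add_sub_cancel_left]

/-- Induction on `T`, charging measure to growth. While the current point `y` stays, everything new
is in the crossing set from `y`. When `y` jumps, that set is moved to `R` and the search restarts
with an empty interval. The term (b y - b u) / d pays for jumps since `u`. When `u` itself jumps,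
its maximality for b - c * a converts growth of b into at most c times growth of a. -/
theorem exists_crossSet_subset (ha : Monotone a) (hb : Monotone b) (hc : 0 < c) (hd : 0 < d)
    {n p T : ℕ}
    (ih : ∀ y T, y ≤ T → d * a T - b T ≤ d * a y - b y →
      volume (crossSet a b c d n y T) ≤
        ENNReal.ofReal (((c / d) ^ n * ((b T - b y) / d) : ℚ) : ℝ))
    (hpT : p ≤ T) :
    ∃ R : Set ℝ, crossSet a b c d (n + 1) p T ⊆ R ∪ crossSet a b c d n (crossStep a b c d T p) T ∧
      volume R ≤ ENNReal.ofReal (((c / d) ^ n * (c / d *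
        (a (lastArgmax (fun s => b s - c * a s) p T) - a p) +
        (b (crossStep a b c d T p) - b (lastArgmax (fun s => b s - c * a s) p T)) / d) : ℚ) : ℝ) := by
  induction T, hpT using Nat.le_induction with
  | base =>
    refine ⟨∅, fun x hx => ?_, by simp⟩
    obtain ⟨t, h1, h2, h3⟩ := mem_crossSet.1 hx
    obtain rfl := le_antisymm h2 h1
    simp [iterate_crossStep_self] at h3
  | succ T hpT hT =>
    obtain ⟨R, hsub, hR⟩ := hT
    have hκ : 0 < c / d := div_pos hc hd
    have hκn : 0 < (c / d) ^ n := pow_pos hκ n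
    set u := lastArgmax (fun s => b s - c * a s) p T with hu
    have hpu : p ≤ u := le_lastArgmax hpT
    have huT : u ≤ T := lastArgmax_le hpT
    have hy : crossStep a b c d T p = lastArgmax (fun s => d * a s - b s) u T := rfl
    set y := crossStep a b c d T p
    have huy : u ≤ y := hy ▸ le_lastArgmax huT
    have hyT : y ≤ T := hy ▸ lastArgmax_le huT
    have hAu : b T - c * a T ≤ b u - c * a u :=
      apply_le_apply_lastArgmax (g := fun s => b s - c * a s) hpT le_rfl
    have hBy : d * a T - b T ≤ d * a y - b y := by
      rw [hy]; exact apply_le_apply_lastArgmax (g := fun s => d * a s - b s) huT le_rfl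
    have hu' := lastArgmax_succ (g := fun s => b s - c * a s) hpT
    have hy' := lastArgmax_succ (g := fun s => d * a s - b s) huT
    rw [← hu] at hu'
    rw [← hy] at hy'
    set u' := lastArgmax (fun s => b s - c * a s) p (T + 1) with hu'def
    have hy'def : crossStep a b c d (T + 1) p = lastArgmax (fun s => d * a s - b s) u' (T + 1) := rfl
    set y' := crossStep a b c d (T + 1) p
    have hsplit : ∀ x ∈ crossSet a b c d (n + 1) p (T + 1), x ∈ crossSet a b c d (n + 1) p T ∨
        x ∈ steepInterval a b d ((crossStep a b c d (T + 1))^[n] y') (T + 1) := fun x hx => by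
      obtain ⟨t, h1, h2, h3⟩ := mem_crossSet.1 hx
      rcases h2.lt_or_eq with hlt | rfl
      · exact Or.inl (mem_crossSet.2 ⟨t, h1, by omega, h3⟩)
      · exact Or.inr (by rwa [Function.iterate_succ_apply] at h3)
    have hmT := ha T.le_succ
    have hbT := hb T.le_succ
    have hbu := hb huy
    have hby := hb hyT
    have hau := ha hpu
    -- Common to both kinds of jump: the old crossing set joins `R`, and its cost (b T - b y) / d
    -- telescopes with (b y - b u) / d.
    have hreset : y' = T + 1 → ∃ R : Set ℝ, crossSet a b c d (n + 1) p (T + 1) ⊆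
        R ∪ crossSet a b c d n y' (T + 1) ∧ volume R ≤ ENNReal.ofReal
          (((c / d) ^ n * (c / d * (a u - a p) + (b T - b u) / d) : ℚ) : ℝ) := fun h => by
      refine ⟨R ∪ crossSet a b c d n y T, fun x hx => Or.inl ?_, ?_⟩
      · rcases hsplit x hx with hx | hx
        · exact hsub hx
        · rw [h, iterate_crossStep_self, steepInterval_self] at hx
          exact hx.elim
      · refine (measure_union_le _ _).trans ((add_le_add hR (ih y T hyT hBy)).trans ?_)
        rw [← ENNReal.ofReal_add, ← Rat.cast_add]
        · refine ENNReal.ofReal_le_ofReal (Rat.cast_le.2 (le_of_eq ?_))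
          ring
        · refine Rat.cast_nonneg.2 (mul_nonneg hκn.le (add_nonneg (mul_nonneg hκ.le ?_)
            (div_nonneg ?_ hd.le))) <;> linarith
        · exact Rat.cast_nonneg.2 (mul_nonneg hκn.le (div_nonneg (by linarith) hd.le))
    split_ifs at hu' with hcu
    · have hyy : y' = T + 1 := by rw [hy'def, hu', lastArgmax_self]
      obtain ⟨R', h1, h2⟩ := hreset hyy
      refine ⟨R', h1, h2.trans (ENNReal.ofReal_le_ofReal (Rat.cast_le.2
        (mul_le_mul_of_nonneg_left ?_ hκn.le)))⟩
      rw [hyy, hu', sub_self, zero_div, add_zero]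
      have : (b T - b u) / d ≤ c / d * (a (T + 1) - a u) := by
        rw [div_mul_eq_mul_div]
        gcongr
        nlinarith
      linarith
    · rw [hy'def, hu'] at hreset ⊢
      rw [hy'def, hu'] at hsplit
      split_ifs at hy' with hcy
      · obtain ⟨R', h1, h2⟩ := hreset hy'
        refine ⟨R', h1, h2.trans (ENNReal.ofReal_le_ofReal (Rat.cast_le.2
          (mul_le_mul_of_nonneg_left ?_ hκn.le)))⟩
        rw [hy']
        gcongr
      · rw [hy'] at hsplit ⊢
        refine ⟨R, fun x hx => ?_, hR⟩
        rcases hsplit x hx with hx | hx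
        · exact (hsub hx).imp id fun h => crossSet_mono T.le_succ h
        · exact Or.inr (mem_crossSet.2 ⟨T + 1, by omega, le_rfl, hx⟩)

/-- Adding the abandoned part and the current part leaves (b T - b u) / d, which is at most (c / d)
* (a T - a u) as `u` maximizes b - c * a. This is where a round gains the factor c / d. -/
theorem volume_crossSet_succ_le_of (ha : Monotone a) (hb : Monotone b) (hc : 0 < c) (hd : 0 < d)
    {n p T : ℕ}
    (ih : ∀ y T, y ≤ T → d * a T - b T ≤ d * a y - b y →
      volume (crossSet a b c d n y T) ≤
        ENNReal.ofReal (((c / d) ^ n * ((b T - b y) / d) : ℚ) : ℝ))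
    (hpT : p ≤ T) :
    volume (crossSet a b c d (n + 1) p T) ≤
      ENNReal.ofReal (((c / d) ^ (n + 1) * (a T - a p) : ℚ) : ℝ) := by
  obtain ⟨R, hsub, hR⟩ := exists_crossSet_subset ha hb hc hd ih hpT
  have hκ : 0 < c / d := div_pos hc hd
  have hκn : 0 < (c / d) ^ n := pow_pos hκ n
  set u := lastArgmax (fun s => b s - c * a s) p T with hu
  have hpu : p ≤ u := le_lastArgmax hpT
  have huT : u ≤ T := lastArgmax_le hpT
  have hy : crossStep a b c d T p = lastArgmax (fun s => d * a s - b s) u T := rfl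
  set y := crossStep a b c d T p
  have huy : u ≤ y := hy ▸ le_lastArgmax huT
  have hyT : y ≤ T := hy ▸ lastArgmax_le huT
  have hAu : b T - c * a T ≤ b u - c * a u :=
    apply_le_apply_lastArgmax (g := fun s => b s - c * a s) hpT le_rfl
  have hBy : d * a T - b T ≤ d * a y - b y := by
    rw [hy]; exact apply_le_apply_lastArgmax (g := fun s => d * a s - b s) huT le_rfl
  have hbu := hb huy
  have hby := hb hyT
  have hau := ha hpu
  refine (measure_mono hsub).trans ((measure_union_le _ _).trans
    ((add_le_add hR (ih y T hyT hBy)).trans ?_))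
  rw [← ENNReal.ofReal_add, ← Rat.cast_add]
  · refine ENNReal.ofReal_le_ofReal (Rat.cast_le.2 ?_)
    rw [← mul_add, pow_succ, mul_assoc]
    refine mul_le_mul_of_nonneg_left ?_ hκn.le
    have : (b T - b u) / d ≤ c / d * (a T - a u) := by
      rw [div_mul_eq_mul_div]
      gcongr
      linarith
    rw [add_assoc, ← add_div]
    have e : b y - b u + (b T - b y) = b T - b u := by ring
    rw [e]
    linarith
  · refine Rat.cast_nonneg.2 (mul_nonneg hκn.le (add_nonneg (mul_nonneg hκ.le ?_)
      (div_nonneg ?_ hd.le))) <;> linarith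
  · exact Rat.cast_nonneg.2 (mul_nonneg hκn.le (div_nonneg (by linarith) hd.le))

/-- The hypothesis says that b grows at least d times as much as a from `y` to `T`, which turns a
bound in terms of a back into one in terms of b and closes the induction. -/
theorem volume_crossSet_le (ha : Monotone a) (hb : Monotone b) (hc : 0 < c) (hd : 0 < d)
    (n : ℕ) : ∀ y T, y ≤ T → d * a T - b T ≤ d * a y - b y →
      volume (crossSet a b c d n y T) ≤
        ENNReal.ofReal (((c / d) ^ n * ((b T - b y) / d) : ℚ) : ℝ) := by
  induction n with
  | zero =>
    intro y T _ _
    simpa using volume_crossSet_zero_le (a := a) (c := c) hb hd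
  | succ n ih =>
    intro y T hyT hB
    refine (volume_crossSet_succ_le_of ha hb hc hd ih hyT).trans
      (ENNReal.ofReal_le_ofReal (Rat.cast_le.2 ?_))
    have : a T - a y ≤ (b T - b y) / d := by
      rw [le_div_iff₀ hd]; linarith
    gcongr

theorem volume_crossSet_succ_le (ha : Monotone a) (hb : Monotone b) (hc : 0 < c) (hd : 0 < d)
    {n p T : ℕ} (hpT : p ≤ T) : volume (crossSet a b c d (n + 1) p T) ≤
      ENNReal.ofReal (((c / d) ^ (n + 1) * (a T - a p) : ℚ) : ℝ) :=
  volume_crossSet_succ_le_of ha hb hc hd (volume_crossSet_le ha hb hc hd n) hpT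

variable {α β : ℝ}

/-- A slope below c at `s` means that b - c * a exceeds its limit at `s`, so the first argmax
stabilizes. A slope above d then stabilizes the second one in the same way, at a point whose own
slope exceeds d. -/
theorem exists_eventually_iterate_crossStep_eq
    (hα : Tendsto (fun n => (a n : ℝ)) atTop (𝓝 α)) (hβ : Tendsto (fun n => (b n : ℝ)) atTop (𝓝 β))
    (hlow : ∃ᶠ s in atTop, β - c * α < b s - c * a s)
    (hhigh : ∃ᶠ s in atTop, d * α - β < d * a s - b s) (n : ℕ) :
    ∃ y, (∀ᶠ t in atTop, (crossStep a b c d t)^[n + 1] 0 = y) ∧ d * α - β < d * a y - b y := by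
  have key : ∀ p, ∃ y, (∀ᶠ t in atTop, crossStep a b c d t p = y) ∧
      d * α - β < d * a y - b y := fun p => by
    obtain ⟨s, hps, hs⟩ := frequently_atTop.1 hlow p
    obtain ⟨u, hpu, -, hu⟩ := exists_eventually_lastArgmax_eq (g := fun s => b s - c * a s) hps (by
      filter_upwards [(hβ.sub (hα.const_mul (c : ℝ))).eventually_lt_const hs] with t ht
      exact_mod_cast ht)
    obtain ⟨s', hus, hs'⟩ := frequently_atTop.1 hhigh u
    obtain ⟨y, -, hsy, hy⟩ := exists_eventually_lastArgmax_eq (g := fun s => d * a s - b s) hus (by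
      filter_upwards [((hα.const_mul (d : ℝ)).sub hβ).eventually_lt_const hs'] with t ht
      exact_mod_cast ht)
    refine ⟨y, ?_, hs'.trans_le (by exact_mod_cast hsy)⟩
    filter_upwards [hu, hy] with t htu hty
    rw [crossStep, htu, hty]
  induction n with
  | zero => exact key 0
  | succ n ih =>
    obtain ⟨p, hp, -⟩ := ih
    obtain ⟨y, hy, hlt⟩ := key p
    refine ⟨y, ?_, hlt⟩
    filter_upwards [hp, hy] with t htp hty
    rw [Function.iterate_succ_apply', htp, hty]

theorem computable_iterate_crossStep (c d : ℚ) (ha : IsComputableRatSeq a) (hb : IsComputableRatSeq b) :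
    Computable fun x : ℕ × ℕ => (crossStep a b c d x.2)^[x.1] 0 := by
  have ca : ComputableRat fun x : (ℕ × ℕ) × ℕ => a x.2 := ComputableRat.comp ha Computable.snd
  have cb : ComputableRat fun x : (ℕ × ℕ) × ℕ => b x.2 := ComputableRat.comp hb Computable.snd
  have hstep : Computable fun x : ℕ × ℕ => crossStep a b c d x.1 x.2 :=
    .lastArgmax (g := fun _ s => d * a s - b s) (((ComputableRat.const d).mul ca).sub cb)
      (.lastArgmax (g := fun _ s => b s - c * a s) (cb.sub ((ComputableRat.const c).mul ca))
        Computable.snd Computable.fst) Computable.fst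
  refine (Computable.nat_rec (f := fun x : ℕ × ℕ => x.1) (g := fun _ => 0)
    (h := fun x p => crossStep a b c d x.2 p.2) Computable.fst (Computable.const 0)
    (hstep.comp ((Computable.snd.comp Computable.fst).pair
      (Computable.snd.comp Computable.snd))).to₂).of_eq fun x => ?_
  obtain ⟨n, t⟩ := x
  induction n with
  | zero => rfl
  | succ n ih => rw [Function.iterate_succ_apply', ← ih]

/-- If `α` is random, then the slopes from `(a s, b s)` to `(α, β)` cannot oscillate: it is not
the case that they are infinitely often below `c` and infinitely often above `d > c`. -/
theorem IsMartinLofRandom.not_frequently_cross (hαr : IsMartinLofRandom α)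
    (ha : IsComputableRatSeq a) (hb : IsComputableRatSeq b) (hma : Monotone a) (hmb : Monotone b)
    (hα : Tendsto (fun n => (a n : ℝ)) atTop (𝓝 α)) (hβ : Tendsto (fun n => (b n : ℝ)) atTop (𝓝 β))
    (hc : 0 < c) (hcd : c < d)
    (hlow : ∃ᶠ s in atTop, β - c * α < b s - c * a s)
    (hhigh : ∃ᶠ s in atTop, d * α - β < d * a s - b s) : False := by
  have hd : 0 < d := hc.trans hcd
  have haα : ∀ n, (a n : ℝ) ≤ α := (Rat.cast_mono.comp hma).ge_of_tendsto hα
  let U : ℕ → Set ℝ := fun n => ⋃ t, steepInterval a b d ((crossStep a b c d t)^[n + 1] 0) t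
  have hU : IsUniformlyEffectivelyOpen U := by
    have hs : Computable fun x : ℕ × ℕ => (x.1 + 1, x.2) :=
      (Computable.succ.comp Computable.fst).pair Computable.snd
    have hy := (computable_iterate_crossStep c d ha hb).comp hs
    have cay : ComputableRat fun x : ℕ × ℕ => a ((crossStep a b c d x.2)^[x.1 + 1] 0) :=
      ComputableRat.comp ha hy
    have cby : ComputableRat fun x : ℕ × ℕ => b ((crossStep a b c d x.2)^[x.1 + 1] 0) :=
      ComputableRat.comp hb hy
    have cbt : ComputableRat fun x : ℕ × ℕ => b x.2 := ComputableRat.comp hb Computable.snd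
    have cr : ComputableRat fun x : ℕ × ℕ => a ((crossStep a b c d x.2)^[x.1 + 1] 0) +
        (b x.2 - b ((crossStep a b c d x.2)^[x.1 + 1] 0)) / d := by
      simpa only [div_eq_mul_inv] using cay.add ((cbt.sub cby).mul (.const d⁻¹))
    exact .of_computableRat cay cr fun i => rfl
  obtain ⟨n, hn⟩ := hαr.exists_notMem hU (C := α - a 0) (κ := ((c / d : ℚ) : ℝ))
    (by exact_mod_cast (div_pos hc hd).le) (by exact_mod_cast (div_lt_one hd).2 hcd) fun n => by
      have e : U n = ⋃ T, crossSet a b c d (n + 1) 0 T := by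
        ext x
        simp only [U, Set.mem_iUnion, mem_crossSet]
        exact ⟨fun ⟨t, h⟩ => ⟨t, t, Nat.zero_le _, le_rfl, h⟩, fun ⟨T, t, _, _, h⟩ => ⟨t, h⟩⟩
      have hmono : Monotone (crossSet a b c d (n + 1) 0) := fun T T' h => crossSet_mono h
      rw [e, hmono.measure_iUnion]
      refine iSup_le fun T => (volume_crossSet_succ_le hma hmb hc hd (Nat.zero_le T)).trans
        (ENNReal.ofReal_le_ofReal ?_)
      have hκ : (0 : ℝ) < c / d := by exact_mod_cast div_pos hc hd
      have hκ1 : (c / d : ℝ) ≤ 1 := by exact_mod_cast ((div_lt_one hd).2 hcd).le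
      have h0 := haα 0
      have hT := haα T
      push_cast
      rw [mul_comm]
      have : (c / d : ℝ) ^ (n + 1) ≤ (c / d : ℝ) ^ n :=
        pow_le_pow_of_le_one hκ.le hκ1 n.le_succ
      calc ((a T : ℝ) - a 0) * (c / d : ℝ) ^ (n + 1) ≤ (α - a 0) * (c / d : ℝ) ^ (n + 1) := by
            gcongr
        _ ≤ _ := by
            gcongr
  obtain ⟨y, hy, hlt⟩ := exists_eventually_iterate_crossStep_eq hα hβ hlow hhigh n
  have hd' : (0 : ℝ) < d := by exact_mod_cast hd
  have hlim : Tendsto (fun t => (a y : ℝ) + (b t - b y) / d) atTop (𝓝 (a y + (β - b y) / d)) :=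
    ((hβ.sub_const _).div_const _).const_add _
  -- The stable point `y` has slope above d, which is exactly membership of α in the limit of its
  -- steep intervals.
  have hαlt : α < a y + (β - b y) / d := by
    rw [← sub_lt_iff_lt_add', lt_div_iff₀ hd']
    linarith
  obtain ⟨t, ht, hty⟩ := ((hlim.eventually_const_lt hαlt).and hy).exists
  refine hn (Set.mem_iUnion.2 ⟨t, ?_⟩)
  rw [hty, steepInterval]
  push_cast
  exact ⟨lt_of_le_of_ne (haα y) fun h => hαr.ne_rat _ h.symm, ht⟩

end Crossing
end RandomReals

namespace RandomReals
open Filter Topology MeasureTheory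

/-! ### Random reals are not approximated too fast from below. -/

section Flat

variable {h a : ℕ → ℚ} {x α : ℝ}

/-- `R` collects the intervals of abandoned argmaxes. Each is no longer than ε times the growth of a
until the next argmax, so the lengths telescope. -/
theorem exists_iUnion_lastArgmax_subset (ha : Monotone a) {ε : ℚ} (hε : 0 ≤ ε) (T : ℕ) :
    ∃ R : Set ℝ, (⋃ t ∈ Set.Iic T, Set.Ioo (h (lastArgmax (fun s => h s - ε * a s) 0 t) : ℝ)
        ((h (lastArgmax (fun s => h s - ε * a s) 0 t) +
          ε * (a t - a (lastArgmax (fun s => h s - ε * a s) 0 t)) : ℚ) : ℝ)) ⊆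
      R ∪ Set.Ioo (h (lastArgmax (fun s => h s - ε * a s) 0 T) : ℝ)
        ((h (lastArgmax (fun s => h s - ε * a s) 0 T) +
          ε * (a T - a (lastArgmax (fun s => h s - ε * a s) 0 T)) : ℚ) : ℝ) ∧
      volume R ≤ ENNReal.ofReal
        ((ε * (a (lastArgmax (fun s => h s - ε * a s) 0 T) - a 0) : ℚ) : ℝ) := by
  set y := lastArgmax (fun s => h s - ε * a s) 0 with hy
  let I : ℕ → ℕ → Set ℝ := fun m t => Set.Ioo (h m : ℝ) ((h m + ε * (a t - a m) : ℚ) : ℝ)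
  change ∃ R : Set ℝ, (⋃ t ∈ Set.Iic T, I (y t) t) ⊆ R ∪ I (y T) T ∧ _
  induction T with
  | zero => exact ⟨∅, by simp, by simp [hy]⟩
  | succ T ih =>
    obtain ⟨R, hsub, hR⟩ := ih
    have hyT : y T ≤ T := lastArgmax_le (Nat.zero_le T)
    have hsplit : (⋃ t ∈ Set.Iic (T + 1), I (y t) t) ⊆
        (⋃ t ∈ Set.Iic T, I (y t) t) ∪ I (y (T + 1)) (T + 1) := by
      refine Set.iUnion₂_subset fun t ht => ?_
      rcases (Set.mem_Iic.1 ht).lt_or_eq with hlt | rfl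
      · exact (Set.subset_biUnion_of_mem (u := fun t => I (y t) t)
          (Set.mem_Iic.2 (by omega))).trans Set.subset_union_left
      · exact Set.subset_union_right
    have hmT := ha T.le_succ
    have hm := ha hyT
    have hy' : y (T + 1) = if h (y T) - ε * a (y T) ≤ h (T + 1) - ε * a (T + 1) then T + 1
      else y T := lastArgmax_succ (Nat.zero_le T)
    split_ifs at hy' with hc
    · refine ⟨R ∪ I (y T) T, hsplit.trans (Set.union_subset_union_left _ hsub), ?_⟩
      refine (measure_union_le _ _).trans ((add_le_add_left hR _).trans ?_)
      rw [Real.volume_Ioo, ← ENNReal.ofReal_add, hy']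
      · apply ENNReal.ofReal_le_ofReal
        rw [← Rat.cast_sub, ← Rat.cast_add, Rat.cast_le]
        nlinarith
      · exact Rat.cast_nonneg.2 (mul_nonneg hε (sub_nonneg.2 (ha (Nat.zero_le _))))
      · rw [← Rat.cast_sub, add_sub_cancel_left]
        exact Rat.cast_nonneg.2 (mul_nonneg hε (sub_nonneg.2 hm))
    · refine ⟨R, hsplit.trans (Set.union_subset (hsub.trans (Set.union_subset_union_right _ ?_)) ?_),
        by rwa [hy']⟩
      · rw [hy']
        refine Set.Ioo_subset_Ioo_right (Rat.cast_le.2 ?_)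
        gcongr
      · exact Set.subset_union_right

/-- A real that is approximated from below much faster than some left-c.e. real is not random. -/
theorem not_isMartinLofRandom_of_forall_exists_lt (hh : IsComputableRatSeq h)
    (hhx : Tendsto (fun n => (h n : ℝ)) atTop (𝓝 x)) (hle : ∀ n, (h n : ℝ) ≤ x)
    (ha : IsComputableRatSeq a) (hma : Monotone a) (hα : Tendsto (fun n => (a n : ℝ)) atTop (𝓝 α))
    (hfast : ∀ ε : ℚ, 0 < ε → ∃ s, x - h s < ε * (α - a s)) : ¬ IsMartinLofRandom x := by
  intro hx
  have haα : ∀ n, (a n : ℝ) ≤ α := (Rat.cast_mono.comp hma).ge_of_tendsto hα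
  let y : ℕ → ℕ → ℕ := fun i t => lastArgmax (fun s => h s - ((2 : ℚ) ^ i)⁻¹ * a s) 0 t
  let U : ℕ → Set ℝ := fun i => ⋃ t, Set.Ioo (h (y i t) : ℝ)
    ((h (y i t) + ((2 : ℚ) ^ i)⁻¹ * (a t - a (y i t)) : ℚ) : ℝ)
  have hU : IsUniformlyEffectivelyOpen U := by
    have ce : ComputableRat fun p : (ℕ × ℕ) × ℕ => ((2 : ℚ) ^ p.1.1)⁻¹ :=
      .two_pow_inv (Computable.fst.comp Computable.fst)
    have cy : Computable fun p : ℕ × ℕ => y p.1 p.2 :=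
      .lastArgmax (g := fun (p : ℕ × ℕ) s => h s - ((2 : ℚ) ^ p.1)⁻¹ * a s)
        ((ComputableRat.comp hh Computable.snd).sub
          (ce.mul (ComputableRat.comp ha Computable.snd)))
        (Computable.const 0) Computable.snd
    have ch : ComputableRat fun p : ℕ × ℕ => h (y p.1 p.2) := ComputableRat.comp hh cy
    have cay : ComputableRat fun p : ℕ × ℕ => a (y p.1 p.2) := ComputableRat.comp ha cy
    have cat : ComputableRat fun p : ℕ × ℕ => a p.2 := ComputableRat.comp ha Computable.snd
    exact .of_computableRat ch
      (ch.add ((ComputableRat.two_pow_inv Computable.fst).mul (cat.sub cay))) fun i => rfl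
  obtain ⟨i, hi⟩ := hx.exists_notMem hU (C := α - a 0) (κ := 1 / 2) (by norm_num) (by norm_num)
    fun i => by
      have hε : (0 : ℚ) ≤ ((2 : ℚ) ^ i)⁻¹ := by positivity
      rw [show U i = ⋃ T, ⋃ t ∈ Set.Iic T, Set.Ioo (h (y i t) : ℝ)
          ((h (y i t) + ((2 : ℚ) ^ i)⁻¹ * (a t - a (y i t)) : ℚ) : ℝ) from
          (Set.iUnion_accumulate (s := fun t => Set.Ioo (h (y i t) : ℝ)
          ((h (y i t) + ((2 : ℚ) ^ i)⁻¹ * (a t - a (y i t)) : ℚ) : ℝ))).symm,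
        Monotone.measure_iUnion (fun T T' hT =>
          Set.biUnion_subset_biUnion_left (Set.Iic_subset_Iic.2 hT))]
      refine iSup_le fun T => ?_
      obtain ⟨R, hsub, hR⟩ := exists_iUnion_lastArgmax_subset (h := h) hma hε T
      have hyT : y i T ≤ T := lastArgmax_le (Nat.zero_le T)
      have hm := hma hyT
      refine (measure_mono hsub).trans ((measure_union_le _ _).trans
        ((add_le_add_left hR _).trans ?_))
      change ENNReal.ofReal ((((2 : ℚ) ^ i)⁻¹ * (a (y i T) - a 0) : ℚ) : ℝ) +
        volume (Set.Ioo (h (y i T) : ℝ)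
          ((h (y i T) + ((2 : ℚ) ^ i)⁻¹ * (a T - a (y i T)) : ℚ) : ℝ)) ≤ _
      rw [Real.volume_Ioo, ← ENNReal.ofReal_add]
      · apply ENNReal.ofReal_le_ofReal
        have : (a T : ℝ) - a 0 ≤ α - a 0 := by linarith [haα T]
        have h2 : (0 : ℝ) ≤ ((2 : ℝ) ^ i)⁻¹ := by positivity
        push_cast
        rw [one_div, inv_pow]
        nlinarith
      · exact Rat.cast_nonneg.2 (mul_nonneg hε (sub_nonneg.2 (hma (Nat.zero_le _))))
      · rw [← Rat.cast_sub, add_sub_cancel_left]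
        exact Rat.cast_nonneg.2 (mul_nonneg hε (sub_nonneg.2 hm))
  have hε : (0 : ℚ) < ((2 : ℚ) ^ i)⁻¹ := by positivity
  obtain ⟨s, hs⟩ := hfast _ hε
  set ε := ((2 : ℚ) ^ i)⁻¹ with hεdef
  -- The value of h - ε * a at `s` exceeds the limit x - εα, so the argmax stabilizes at some `m`,
  -- and `x` is within ε(α - a m) of `h m`.
  have hs' : x - ε * α < h s - ε * a s := by linarith
  obtain ⟨m, -, hsm, hm⟩ := exists_eventually_lastArgmax_eq (g := fun s => h s - ε * a s)
    (Nat.zero_le s) (by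
      filter_upwards [(hhx.sub (hα.const_mul (ε : ℝ))).eventually_lt_const hs'] with t ht
      exact_mod_cast ht)
  have hsm' : (h s : ℝ) - ε * a s ≤ h m - ε * a m := by exact_mod_cast hsm
  have hlim : Tendsto (fun t => (h m : ℝ) + ε * (a t - a m)) atTop (𝓝 (h m + ε * (α - a m))) :=
    ((hα.sub_const _).const_mul _).const_add _
  have hxm : x < h m + ε * (α - a m) := by linarith
  obtain ⟨t, ht, htm⟩ := ((hlim.eventually_const_lt hxm).and hm).exists
  refine hi (Set.mem_iUnion.2 ⟨t, ?_⟩)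
  have hyt : y i t = m := htm
  rw [hyt]
  push_cast [hεdef] at ht ⊢
  exact ⟨lt_of_le_of_ne (hle m) fun h => hx.ne_rat _ h.symm, ht⟩

end Flat

/-! ### Computable sequences of bounded variation. -/

section BoundedVariation

theorem _root_.Computable.nat_count {σ : Type*} [Primcodable σ] {P : σ → ℕ → Prop}
    [∀ x, DecidablePred (P x)] {T : σ → ℕ} (hT : Computable T)
    (hP : Computable fun y : σ × ℕ => decide (P y.1 y.2)) :
    Computable fun x => Nat.count (P x) (T x) := by
  refine (Computable.nat_rec hT (Computable.const 0)
    (h := fun x p => p.2 + if P x p.1 then 1 else 0)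
    ((Computable.snd.comp Computable.snd).nat_add (Computable.ite_decide
      (hP.comp (Computable.fst.pair (Computable.fst.comp Computable.snd)))
      (Computable.const 1) (Computable.const 0))).to₂).of_eq fun x => ?_
  induction T x with
  | zero => simp
  | succ n ih => rw [Nat.count_succ, ← ih]

variable {h g : ℕ → ℚ} {x C : ℝ}

/-- A real at which the consecutive segments of a computable sequence of bounded variation
overlap infinitely often is not random. -/
theorem not_isMartinLofRandom_of_frequently_mem_Ioo (hh : IsComputableRatSeq h)
    (hvar : ∀ n, |h (n + 1) - h n| ≤ g (n + 1) - g n) (hg : ∀ n, (g n : ℝ) ≤ C)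
    (hfreq : ∃ᶠ n in atTop, x ∈ Set.Ioo ((min (h n) (h (n + 1)) : ℚ) : ℝ)
      ((max (h n) (h (n + 1)) : ℚ) : ℝ)) : ¬ IsMartinLofRandom x := by
  intro hx
  let lo : ℕ → ℚ := fun n => min (h n) (h (n + 1))
  let hi : ℕ → ℚ := fun n => max (h n) (h (n + 1))
  let τ := (ℕ × ℕ × ℕ) × (ℕ × ℕ × ℕ) × ℕ
  let P : τ → ℕ → Prop := fun p n => lo n ≤ ratOfCode p.1 ∧ ratOfCode p.2.1 ≤ hi n
  -- `p` codes a rational interval and a stage. The interval is listed once at least 2 ^ i segments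
  -- seen by that stage contain it.
  let U : ℕ → Set ℝ := fun i => ⋃ p : τ, Set.Ioo (ratOfCode p.1 : ℝ)
    ((if 2 ^ i ≤ Nat.count (P p) p.2.2 then ratOfCode p.2.1 else ratOfCode p.1 : ℚ) : ℝ)
  have hU : IsUniformlyEffectivelyOpen U := by
    have cr : ComputableRat ratOfCode := ⟨id, Computable.id, fun _ => rfl⟩
    have c1 : ComputableRat fun p : ℕ × τ => ratOfCode p.2.1 :=
      cr.comp (Computable.fst.comp Computable.snd)
    have c2 : ComputableRat fun p : ℕ × τ => ratOfCode p.2.2.1 :=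
      cr.comp (Computable.fst.comp (Computable.snd.comp Computable.snd))
    have ch : ComputableRat fun p : (ℕ × τ) × ℕ => h p.2 := ComputableRat.comp hh Computable.snd
    have ch' : ComputableRat fun p : (ℕ × τ) × ℕ => h (p.2 + 1) :=
      ComputableRat.comp hh (Computable.succ.comp Computable.snd)
    have clo : ComputableRat fun p : (ℕ × τ) × ℕ => lo p.2 := by
      simpa only [lo, min_def] using ComputableRat.ite_decide (ch.decide_le ch') ch ch'
    have chi : ComputableRat fun p : (ℕ × τ) × ℕ => hi p.2 := by
      simpa only [hi, max_def] using ComputableRat.ite_decide (ch.decide_le ch') ch' ch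
    have cP : Computable fun p : (ℕ × τ) × ℕ => decide (P p.1.2 p.2) := by
      refine (Primrec.and.to_comp.comp (clo.decide_le (c1.comp Computable.fst))
        ((c2.comp Computable.fst).decide_le chi)).of_eq fun p => ?_
      simp only [P, Bool.decide_and]
    have ccount : Computable fun p : ℕ × τ => Nat.count (P p.2) p.2.2.2 :=
      .nat_count (P := fun p : ℕ × τ => P p.2)
        (Computable.snd.comp (Computable.snd.comp Computable.snd)) cP
    have cle : Computable fun p : ℕ × τ => decide (2 ^ p.1 ≤ Nat.count (P p.2) p.2.2.2) := by
      -- The comparison is decided in the form 1 ≤ count * 2⁻ⁱ.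
      refine ((ComputableRat.natCast (Computable.const 1)).decide_le
        ((ComputableRat.natCast ccount).mul
          (ComputableRat.two_pow_inv Computable.fst))).of_eq fun p => ?_
      congr 1
      rw [eq_iff_iff, ← div_eq_mul_inv, le_div_iff₀ (by positivity), Nat.cast_one, one_mul]
      exact_mod_cast Iff.rfl
    exact .of_computableRat c1 (.ite_decide cle c2 c1) fun i => rfl
  -- `f` counts the segments over a point. Its integral is at most the total variation, so Markov's
  -- inequality bounds the measure of `U i`.
  let f : ℝ → ENNReal := fun z => ∑' n, (Set.Ioo (lo n : ℝ) (hi n : ℝ)).indicator 1 z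
  have hf : Measurable f := Measurable.tsum fun n =>
    measurable_one.indicator measurableSet_Ioo
  have hint : ∫⁻ z, f z ≤ ENNReal.ofReal (C - g 0) := by
    rw [lintegral_tsum fun n => (measurable_one.indicator measurableSet_Ioo).aemeasurable]
    simp_rw [lintegral_indicator_one measurableSet_Ioo, Real.volume_Ioo]
    refine ENNReal.tsum_le_of_sum_range_le fun N => ?_
    rw [← ENNReal.ofReal_sum_of_nonneg fun n _ => sub_nonneg.2 (Rat.cast_le.2 min_le_max)]
    apply ENNReal.ofReal_le_ofReal
    have hterm : ∀ n, (hi n : ℝ) - lo n ≤ g (n + 1) - g n := fun n => by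
      have := hvar n
      rw [abs_sub_comm, ← max_sub_min_eq_abs'] at this
      exact_mod_cast this
    calc ∑ n ∈ Finset.range N, ((hi n : ℝ) - lo n)
        ≤ ∑ n ∈ Finset.range N, ((g (n + 1) : ℝ) - g n) := Finset.sum_le_sum fun n _ => hterm n
      _ = g N - g 0 := Finset.sum_range_sub (fun n => (g n : ℝ)) N
      _ ≤ C - g 0 := by linarith [hg N]
  obtain ⟨i, hi'⟩ := hx.exists_notMem hU (C := C - g 0) (κ := 1 / 2) (by norm_num) (by norm_num)
    fun i => by
      have hsub : U i ⊆ {z | (2 : ENNReal) ^ i ≤ f z} := by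
        refine Set.iUnion_subset fun p z hz => ?_
        split_ifs at hz with hc
        · have hterm : ∀ n, (if P p n then 1 else 0 : ENNReal) ≤
              (Set.Ioo (lo n : ℝ) (hi n : ℝ)).indicator 1 z := fun n => by
            split_ifs with hP
            · rw [Set.indicator_of_mem]
              · rfl
              · exact ⟨(Rat.cast_le.2 hP.1).trans_lt hz.1, hz.2.trans_le (Rat.cast_le.2 hP.2)⟩
            · exact zero_le
          calc (2 : ENNReal) ^ i ≤ (Nat.count (P p) p.2.2 : ENNReal) := by exact_mod_cast hc
            _ = ∑ n ∈ Finset.range p.2.2, (if P p n then 1 else 0 : ENNReal) := by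
              rw [Nat.count_eq_card_filter_range, Finset.sum_boole]
            _ ≤ ∑ n ∈ Finset.range p.2.2, (Set.Ioo (lo n : ℝ) (hi n : ℝ)).indicator 1 z :=
              Finset.sum_le_sum fun n _ => hterm n
            _ ≤ f z := ENNReal.sum_le_tsum _
        · simp at hz
      refine (measure_mono hsub).trans ((meas_ge_le_lintegral_div hf.aemeasurable
        (by positivity) (ENNReal.pow_ne_top (by simp))).trans ?_)
      refine (ENNReal.div_le_div_right hint _).trans (le_of_eq ?_)
      rw [mul_comm, ENNReal.ofReal_mul (by positivity), ENNReal.ofReal_pow (by positivity), one_div,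
        ENNReal.ofReal_inv_of_pos two_pos, ENNReal.div_eq_inv_mul, ENNReal.inv_pow]
      simp
  obtain ⟨F, hF, hcard⟩ := (Nat.frequently_atTop_iff_infinite.1 hfreq).exists_subset_card_eq (2 ^ i)
  have hne : F.Nonempty := Finset.card_pos.1 (by rw [hcard]; positivity)
  -- The intersection of 2 ^ i segments around `x` runs from the largest lower end to the smallest
  -- upper end.
  obtain ⟨m, hm, hmax⟩ := F.exists_max_image lo hne
  obtain ⟨k, hk, hmin⟩ := F.exists_min_image hi hne
  obtain ⟨cm, hcm⟩ := exists_ratOfCode (lo m)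
  obtain ⟨ck, hck⟩ := exists_ratOfCode (hi k)
  refine hi' (Set.mem_iUnion.2 ⟨(cm, ck, F.sup id + 1), ?_⟩)
  have hcount : 2 ^ i ≤ Nat.count (P (cm, ck, F.sup id + 1)) (F.sup id + 1) := by
    rw [← hcard, Nat.count_eq_card_filter_range]
    refine Finset.card_le_card fun n hn => Finset.mem_filter.2 ⟨Finset.mem_range.2 ?_, ?_, ?_⟩
    · exact Nat.lt_succ_of_le (Finset.le_sup (f := id) hn)
    · exact (hmax n hn).trans_eq hcm
    · exact hck.symm.trans_le (hmin n hn)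
  rw [if_pos hcount]
  exact ⟨hcm ▸ (hF hm).1, hck ▸ (hF hk).2⟩

/-- A real that is crossed infinitely often by a computable sequence of bounded variation is not
random. -/
theorem not_isMartinLofRandom_of_frequently_lt_of_frequently_gt (hh : IsComputableRatSeq h)
    (hvar : ∀ n, |h (n + 1) - h n| ≤ g (n + 1) - g n) (hg : ∀ n, (g n : ℝ) ≤ C)
    (hlt : ∃ᶠ n in atTop, (h n : ℝ) < x) (hgt : ∃ᶠ n in atTop, x < (h n : ℝ)) :
    ¬ IsMartinLofRandom x := by
  intro hx
  refine not_isMartinLofRandom_of_frequently_mem_Ioo hh hvar hg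
    (frequently_atTop.2 fun N => ?_) hx
  obtain ⟨s, hNs, hs⟩ := frequently_atTop.1 hlt N
  obtain ⟨t, hst, ht⟩ := frequently_atTop.1 hgt s
  -- A sequence that is below `x` can only get above it through a segment containing `x`, because
  -- `x` is irrational.
  by_contra! hno
  have : ∀ n, s ≤ n → (h n : ℝ) < x := fun n hn => by
    induction n, hn using Nat.le_induction with
    | base => exact hs
    | succ n hn ih =>
      by_contra hge
      have hge' : x < h (n + 1) := lt_of_le_of_ne (not_lt.1 hge) (hx.ne_rat _)
      refine hno n (by omega) ⟨?_, ?_⟩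
      · exact (Rat.cast_le.2 (min_le_left _ _)).trans_lt ih
      · exact hge'.trans_le (Rat.cast_le.2 (le_max_right _ _))
  exact (this t hst).not_gt ht

end BoundedVariation
end RandomReals

/-! ### The function D, the trichotomy and the theorem. -/

namespace RandomReals
open Filter Topology

variable {α β : ℝ}

theorem D_le {q : ℚ} (hq : 0 < q) (h : IsLeftCE (q * α - β)) : D α β ≤ ((q : ℝ) : EReal) :=
  sInf_le ⟨q, hq, h, rfl⟩

theorem exists_isLeftCE_of_D_lt {q : ℚ} (h : D α β < ((q : ℝ) : EReal)) :
    ∃ r : ℚ, r < q ∧ IsLeftCE (r * α - β) := by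
  obtain ⟨_, ⟨r, -, hr, rfl⟩, hlt⟩ := sInf_lt_iff.1 h
  exact ⟨r, by exact_mod_cast EReal.coe_lt_coe_iff.1 hlt, hr⟩

/-- If rα - β were left-c.e. for some r < q, adding β - qα would make (q - r)α right-c.e. as well as
left-c.e., although it is random. -/
theorem le_D_of_isLeftCE_sub (hα : IsLeftCE α) (hαr : IsMartinLofRandom α) {q : ℚ}
    (h : IsLeftCE (β - q * α)) : ((q : ℝ) : EReal) ≤ D α β := by
  refine le_of_not_gt fun hlt => ?_
  obtain ⟨r, hrq, hr⟩ := exists_isLeftCE_of_D_lt hlt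
  have hqr : 0 < q - r := sub_pos.2 hrq
  refine not_isMartinLofRandom_of_isLeftCE_of_isRightCE (hα.rat_mul hqr.le) ?_
    (hαr.rat_mul hqr.ne')
  convert (h.add hr).neg using 1
  push_cast
  ring

theorem IsMartinLofRandom.sub_of_isLeftCE (hα : IsLeftCE α) (hαr : IsMartinLofRandom α)
    {q : ℚ} (hq : q < 1) (h : IsLeftCE (q * α - β)) :
    IsMartinLofRandom (α - β) ∧ IsLeftCE (α - β) := by
  have hq' : 0 < 1 - q := sub_pos.2 hq
  have e : α - β = ((1 - q : ℚ) : ℝ) * α + (q * α - β) := by push_cast; ring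
  rw [e]
  exact ⟨(hαr.rat_mul hq'.ne').add (hα.rat_mul hq'.le) h, (hα.rat_mul hq'.le).add h⟩

theorem IsMartinLofRandom.sub_of_isLeftCE_sub (hα : IsLeftCE α) (hαr : IsMartinLofRandom α)
    {q : ℚ} (hq : 1 < q) (h : IsLeftCE (β - q * α)) :
    IsMartinLofRandom (α - β) ∧ IsRightCE (α - β) := by
  have hq' : 0 < q - 1 := sub_pos.2 hq
  have e : α - β = -(((q - 1 : ℚ) : ℝ) * α + (β - q * α)) := by push_cast; ring
  rw [e]
  exact ⟨((hαr.rat_mul hq'.ne').add (hα.rat_mul hq'.le) h).neg, ((hα.rat_mul hq'.le).add h).neg⟩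

/-- If the slopes from `(a s, b s)` to `(α, β)` tend to `1`, then `α - β` is not random. -/
theorem not_isMartinLofRandom_sub {a b : ℕ → ℚ} (hαr : IsMartinLofRandom α)
    (ha : IsComputableRatSeq a) (hb : IsComputableRatSeq b) (hma : Monotone a) (hmb : Monotone b)
    (hα : Tendsto (fun n => (a n : ℝ)) atTop (𝓝 α)) (hβ : Tendsto (fun n => (b n : ℝ)) atTop (𝓝 β))
    (hlow : ∀ c : ℚ, 0 < c → c < 1 → ∀ᶠ s in atTop, (b s : ℝ) - c * a s ≤ β - c * α)
    (hhigh : ∀ d : ℚ, 1 < d → ∀ᶠ s in atTop, (d : ℝ) * a s - b s ≤ d * α - β) :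
    ¬ IsMartinLofRandom (α - β) := by
  intro hr
  have haα : ∀ n, (a n : ℝ) ≤ α := (Rat.cast_mono.comp hma).ge_of_tendsto hα
  have hbβ : ∀ n, (b n : ℝ) ≤ β := (Rat.cast_mono.comp hmb).ge_of_tendsto hβ
  have haα' : ∀ n, (a n : ℝ) < α := fun n => lt_of_le_of_ne (haα n) (hαr.ne_rat _).symm
  have hh : IsComputableRatSeq fun n => a n - b n := ComputableRat.sub ha hb
  have shift : ∀ {f : ℕ → ℚ} (N : ℕ), IsComputableRatSeq f →
      IsComputableRatSeq fun n => f (n + N) := fun N hf =>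
    ComputableRat.comp hf (Computable.id.nat_add (Computable.const N))
  by_cases hlt : ∃ᶠ n in atTop, ((a n - b n : ℚ) : ℝ) < α - β
  · by_cases hgt : ∃ᶠ n in atTop, α - β < ((a n - b n : ℚ) : ℝ)
    · refine not_isMartinLofRandom_of_frequently_lt_of_frequently_gt hh
        (g := fun n => a n + b n) (C := α + β) (fun n => ?_) (fun n => ?_) hlt hgt hr
      · have := hma n.le_succ
        have := hmb n.le_succ
        simp only [Nat.succ_eq_add_one] at *
        rw [abs_le]
        constructor <;> linarith
      · push_cast
        linarith [haα n, hbβ n]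
    · obtain ⟨N, hN⟩ := eventually_atTop.1 (not_frequently.1 hgt)
      refine not_isMartinLofRandom_of_forall_exists_lt (h := fun n => a (n + N) - b (n + N))
        (a := a ∘ (· + N)) (α := α) (shift N hh) ?_
        (fun n => not_lt.1 (hN _ (by omega))) (shift N ha)
        (hma.comp fun _ _ h => by simpa using h) (hα.comp (tendsto_add_atTop_nat N))
        (fun ε hε => ?_) hr
      · push_cast
        exact (hα.sub hβ).comp (tendsto_add_atTop_nat N)
      · obtain ⟨M, hM⟩ := eventually_atTop.1 (hlow (max (1 - ε / 2) (1 / 2)) (by positivity)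
          (max_lt (by linarith) (by norm_num)))
        refine ⟨M, ?_⟩
        have h1 := hM (M + N) (by omega)
        have h2 := haα' (M + N)
        have h3 : (1 - ε / 2 : ℝ) ≤ ((max (1 - ε / 2) (1 / 2) : ℚ) : ℝ) := by
          exact_mod_cast le_max_left (1 - ε / 2) (1 / 2 : ℚ)
        have hε' : (0 : ℝ) < ε := by exact_mod_cast hε
        simp only [Function.comp]
        push_cast at *
        nlinarith [mul_pos hε' (sub_pos.2 h2), mul_le_mul_of_nonneg_right h3 (sub_pos.2 h2).le]
  -- Here the approximation is eventually from above, so the argument is applied to β - α.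
  · obtain ⟨N, hN⟩ := eventually_atTop.1 (not_frequently.1 hlt)
    refine not_isMartinLofRandom_of_forall_exists_lt (h := fun n => -(a (n + N) - b (n + N)))
      (a := a ∘ (· + N)) (α := α) (ComputableRat.neg (shift N hh)) ?_
      (fun n => ?_) (shift N ha)
      (hma.comp fun _ _ h => by simpa using h) (hα.comp (tendsto_add_atTop_nat N))
      (fun ε hε => ?_) hr.neg
    · push_cast
      exact (hα.sub hβ).neg.comp (tendsto_add_atTop_nat N)
    · rw [Rat.cast_neg]
      exact neg_le_neg (not_lt.1 (hN _ (by omega)))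
    · obtain ⟨M, hM⟩ := eventually_atTop.1 (hhigh (1 + ε / 2) (by linarith))
      refine ⟨M, ?_⟩
      have h1 := hM (M + N) (by omega)
      have h2 := haα' (M + N)
      have hε' : (0 : ℝ) < ε := by exact_mod_cast hε
      simp only [Function.comp]
      push_cast at *
      nlinarith [mul_pos hε' (sub_pos.2 h2)]

/-- The trichotomy for differences of random left-c.e. reals. -/
theorem trichotomy (hα : IsLeftCE α) (hαr : IsMartinLofRandom α) (hβ : IsLeftCE β) :
    (∃ q : ℚ, 0 < q ∧ q < 1 ∧ IsLeftCE (q * α - β)) ∨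
    (∃ q : ℚ, 1 < q ∧ IsLeftCE (β - q * α)) ∨
    ((∀ q : ℚ, 1 < q → IsLeftCE (q * α - β)) ∧ ¬ IsMartinLofRandom (α - β)) := by
  obtain ⟨a, ha, hma, hta⟩ := hα
  obtain ⟨b, hb, hmb, htb⟩ := hβ
  have hleft : ∀ q : ℚ, (∀ᶠ s in atTop, (q : ℝ) * a s - b s ≤ q * α - β) →
      IsLeftCE (q * α - β) := fun q h =>
    isLeftCE_of_eventually_le (g := fun n => q * a n - b n)
      (ComputableRat.sub (.mul (.const q) ha) hb)
      (by push_cast; exact (hta.const_mul _).sub htb) (by push_cast; exact h)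
  have hright : ∀ q : ℚ, (∀ᶠ s in atTop, (b s : ℝ) - q * a s ≤ β - q * α) →
      IsLeftCE (β - q * α) := fun q h =>
    isLeftCE_of_eventually_le (g := fun n => b n - q * a n)
      (ComputableRat.sub hb (.mul (.const q) ha))
      (by push_cast; exact htb.sub (hta.const_mul _)) (by push_cast; exact h)
  have hcross : ∀ c d : ℚ, 0 < c → c < d →
      (∀ᶠ s in atTop, (b s : ℝ) - c * a s ≤ β - c * α) ∨
      (∀ᶠ s in atTop, (d : ℝ) * a s - b s ≤ d * α - β) := fun c d hc hcd => by
    by_contra! hno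
    exact hαr.not_frequently_cross ha hb hma hmb hta htb hc hcd hno.1 hno.2
  by_cases h1 : ∃ q : ℚ, 0 < q ∧ q < 1 ∧ ∀ᶠ s in atTop, (q : ℝ) * a s - b s ≤ q * α - β
  · obtain ⟨q, h0, hq, h⟩ := h1
    exact Or.inl ⟨q, h0, hq, hleft q h⟩
  by_cases h2 : ∃ q : ℚ, 1 < q ∧ ∀ᶠ s in atTop, (b s : ℝ) - q * a s ≤ β - q * α
  · obtain ⟨q, hq, h⟩ := h2
    exact Or.inr (Or.inl ⟨q, hq, hright q h⟩)
  have hlow : ∀ c : ℚ, 0 < c → c < 1 → ∀ᶠ s in atTop, (b s : ℝ) - c * a s ≤ β - c * α :=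
    fun c hc hc1 => by
      -- Slopes eventually at most d < 1 are excluded by `h1`, so non-oscillation between c and d
      -- leaves slopes eventually at least c.
      obtain ⟨d, hcd, hd1⟩ := exists_between hc1
      exact (hcross c d hc hcd).resolve_right fun h => h1 ⟨d, hc.trans hcd, hd1, h⟩
  have hhigh : ∀ d : ℚ, 1 < d → ∀ᶠ s in atTop, (d : ℝ) * a s - b s ≤ d * α - β := fun d hd => by
    obtain ⟨c, hc1, hcd⟩ := exists_between hd
    exact (hcross c d (one_pos.trans hc1) hcd).resolve_left fun h => h2 ⟨c, hc1, h⟩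
  exact Or.inr (Or.inr ⟨fun q hq => hleft q (hhigh q hq),
    not_isMartinLofRandom_sub hαr ha hb hma hmb hta htb hlow hhigh⟩)

end RandomReals

theorem theorem1p5 (α β : ℝ)
    (hα : RandomReals.IsLeftCE α) (hαr : RandomReals.IsMartinLofRandom α)
    (hβ : RandomReals.IsLeftCE β) (hβr : RandomReals.IsMartinLofRandom β) :
    (RandomReals.D α β < 1 →
      RandomReals.IsMartinLofRandom (α - β) ∧ RandomReals.IsLeftCE (α - β)) ∧
    (RandomReals.D α β = 1 → ¬ RandomReals.IsMartinLofRandom (α - β)) ∧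
    (1 < RandomReals.D α β →
      RandomReals.IsMartinLofRandom (α - β) ∧ RandomReals.IsRightCE (α - β)) := by
  have e1 : (1 : EReal) = (((1 : ℚ) : ℝ) : EReal) := by simp
  rw [e1]
  refine ⟨fun h => ?_, fun h => ?_, fun h => ?_⟩
  · obtain ⟨q, hq, hleft⟩ := RandomReals.exists_isLeftCE_of_D_lt h
    exact RandomReals.IsMartinLofRandom.sub_of_isLeftCE hα hαr hq hleft
  · rcases RandomReals.trichotomy hα hαr hβ with ⟨q, h0, hq, hleft⟩ | ⟨q, hq, hleft⟩ | ⟨-, hno⟩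
    · have := h ▸ RandomReals.D_le h0 hleft
      rw [EReal.coe_le_coe_iff, Rat.cast_le] at this
      exact absurd this (not_le.2 hq)
    · have := h ▸ RandomReals.le_D_of_isLeftCE_sub hα hαr hleft
      rw [EReal.coe_le_coe_iff, Rat.cast_le] at this
      exact absurd this (not_le.2 hq)
    · exact hno
  · rcases RandomReals.trichotomy hα hαr hβ with ⟨q, h0, hq, hleft⟩ | ⟨q, hq, hleft⟩ | ⟨hall, -⟩
    · have := h.trans_le (RandomReals.D_le h0 hleft)
      rw [EReal.coe_lt_coe_iff, Rat.cast_lt] at this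
      exact absurd this hq.not_gt
    · exact RandomReals.IsMartinLofRandom.sub_of_isLeftCE_sub hα hαr hq hleft
    · obtain ⟨q, hq1, hq2⟩ := EReal.lt_iff_exists_rat_btwn.1 h
      rw [EReal.coe_lt_coe_iff, Rat.cast_lt] at hq1
      exact absurd (RandomReals.D_le (one_pos.trans hq1) (hall q hq1)) (not_le.2 hq2)
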